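/- Let $d\ge 2$. For a number field $K$ and a finite set $S$ of places of $K$ (containing the archimedean ones), let $R_S$ be the ring of $S$-integers. A degree $d$ morphism $f:\mathbb{P}^1_K\to\mathbb{P}^1_K$ has simple good reduction outside $S$ if there is an $R_S$-morphism $\mathbb{P}^1_{R_S}\to\mathbb{P}^1_{R_S}$ whose generic fiber is $\mathrm{PGL}_2(K)$-conjugate to $f$. Let $\mathrm{GR}_d^1[\emptyset](K,S)$ be the set of degree $d$ morphisms $f:\mathbb{P}^1_K\to\mathbb{P}^1_K$ that have simple good reduction outside $S$, let $\mathcal{M}_d^1=\mathrm{End}_d^1/\!/\mathrm{SL}_2$ be the moduli space of degree $d$ endomorphisms of $\mathbb{P}^1$ modulo conjugation (the GIT quotient), and define $$\mathrm{ShafDim}_d^1[\emptyset]=\sup_{K,\,S}\ \dim\overline{\mathrm{Image}\bigl(\mathrm{GR}_d^1[\emptyset](K,S)\to\mathcal{M}_d^1\bigr)},$$ where the supremum is over all number fields $K$ and all finite sets $S$ of places of $K$, and the overline denotes Zariski closure. Then $$\mathrm{ShafDim}_d^1[\emptyset]\ \ge\ d .$$ -/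

import Mathlib

open Polynomial NumberField IsDedekindDomain

/-- The binary form `F = ∑ i, c i X^i Y^(d-i)` of degree `d` with coefficient vector `c`,
written in dehomogenized form `F(X, 1) = ∑ i, c i X^i`. -/
noncomputable def formPoly {R : Type*} [CommRing R] {d : ℕ} (c : Fin (d + 1) → R) : R[X] :=
  ∑ i : Fin (d + 1), C (c i) * X ^ (i : ℕ)

/-- The resultant of the two binary forms `F`, `G` of degree `d` whose coefficient vectors are
`c 0`, `c 1`: the `2d × 2d` Sylvester determinant in the formal degrees `(d, d)`. -/
noncomputable def formRes {R : Type*} [CommRing R] {d : ℕ} (c : Fin 2 → Fin (d + 1) → R) : R :=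
  resultant (formPoly (c 0)) (formPoly (c 1)) d d

/-- The coefficient vector of the binary form `F(αX + βY, γX + δY)`, where `F` is the form with
coefficient vector `c` and `φ = (α β; γ δ)`. -/
noncomputable def formSubst {R : Type*} [CommRing R] {d : ℕ} (φ : Matrix (Fin 2) (Fin 2) R)
    (c : Fin (d + 1) → R) : Fin (d + 1) → R :=
  fun j => (∑ i : Fin (d + 1), C (c i) * (C (φ 0 0) * X + C (φ 0 1)) ^ (i : ℕ) *
    (C (φ 1 0) * X + C (φ 1 1)) ^ (d - (i : ℕ))).coeff j

/-- The degree `d` endomorphisms `f = [F : G]` of the projective line over a field `k`, given by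
homogeneous lifts: pairs of forms `F = c 0`, `G = c 1` of degree `d` whose resultant does not
vanish (that is, without a common zero). Two lifts give the same endomorphism if and only
if they are proportional; every notion below is insensitive to rescaling the lift. -/
def EndLift (k : Type*) [Field k] (d : ℕ) : Type _ :=
  {c : Fin 2 → Fin (d + 1) → k // formRes c ≠ 0}

/-- `f` and `g` are conjugate by an element of `PGL_2(k)`: there is `φ` with `f ∘ φ = φ ∘ g` as
self-maps of the projective line, i.e. `g = φ⁻¹ ∘ f ∘ φ`. Since forms are determined only up to
a common factor, the equality holds up to a unit `u`. -/
def EndConj {k : Type*} [Field k] {d : ℕ} (f g : EndLift k d) : Prop :=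
  ∃ (φ : GL (Fin 2) k) (u : kˣ), ∀ i : Fin 2,
    formSubst (φ : Matrix (Fin 2) (Fin 2) k) (f.1 i) =
      (u : k) • ∑ j : Fin 2, (φ : Matrix (Fin 2) (Fin 2) k) i j • g.1 j

/-- The resultant, as a polynomial in the `2(d+1)` coefficients. -/
noncomputable def resPoly (k : Type*) [Field k] (d : ℕ) : MvPolynomial (Fin 2 × Fin (d + 1)) k :=
  formRes fun i j => MvPolynomial.X (i, j)

theorem formPoly_map {R S : Type*} [CommRing R] [CommRing S] (h : R →+* S) {d : ℕ}
    (c : Fin (d + 1) → R) : (formPoly c).map h = formPoly fun j => h (c j) := by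
  simp [formPoly, Polynomial.map_sum]

theorem formRes_map {R S : Type*} [CommRing R] [CommRing S] (h : R →+* S) {d : ℕ}
    (c : Fin 2 → Fin (d + 1) → R) : formRes (fun i j => h (c i j)) = h (formRes c) := by
  rw [formRes, formRes, ← resultant_map_map, formPoly_map, formPoly_map]

theorem eval_resPoly {k : Type*} [Field k] {d : ℕ} (c : Fin 2 → Fin (d + 1) → k) :
    MvPolynomial.eval (fun ij => c ij.1 ij.2) (resPoly k d) = formRes c := by
  rw [resPoly, ← formRes_map]
  simp

theorem formPoly_coeff {R : Type*} [CommRing R] {d : ℕ} (c : Fin (d + 1) → R) (n : ℕ) :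
    (formPoly c).coeff n = if h : n < d + 1 then c ⟨n, h⟩ else 0 := by
  simp only [formPoly, finsetSum_coeff, coeff_C_mul, coeff_X_pow]
  split_ifs with h
  · rw [Finset.sum_eq_single ⟨n, h⟩]
    · simp
    · intro b _ hb
      have : n ≠ b := fun e => hb (Fin.ext e.symm)
      simp [this]
    · simp
  · refine Finset.sum_eq_zero fun i _ => ?_
    have : n ≠ i := by have := i.2; omega
    simp [this]

theorem formPoly_coeff_isHomogeneous {k : Type*} [Field k] {d : ℕ} (a : Fin 2) (n : ℕ) :
    ((formPoly fun j : Fin (d + 1) =>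
      (MvPolynomial.X (a, j) : MvPolynomial (Fin 2 × Fin (d + 1)) k)).coeff n).IsHomogeneous 1 := by
  rw [formPoly_coeff]
  split_ifs
  · exact MvPolynomial.isHomogeneous_X _ _
  · exact MvPolynomial.isHomogeneous_zero _ _ _

theorem resPoly_isHomogeneous (k : Type*) [Field k] (d : ℕ) :
    (resPoly k d).IsHomogeneous (2 * d) := by
  unfold resPoly formRes resultant
  rw [Matrix.det_apply]
  refine MvPolynomial.IsHomogeneous.sum _ _ _ fun σ _ => ?_
  have key : ∀ i j, (sylvester
      (formPoly fun j => (MvPolynomial.X (0, j) : MvPolynomial (Fin 2 × Fin (d + 1)) k))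
      (formPoly fun j => (MvPolynomial.X (1, j) : MvPolynomial (Fin 2 × Fin (d + 1)) k))
      d d i j).IsHomogeneous 1 := by
    intro i j
    induction j using Fin.addCases <;>
    · simp only [sylvester, Matrix.of_apply, Fin.addCases_left, Fin.addCases_right]
      split_ifs
      · exact formPoly_coeff_isHomogeneous _ _
      · exact MvPolynomial.isHomogeneous_zero _ _ _
  have hp := MvPolynomial.IsHomogeneous.prod Finset.univ
    (fun i => sylvester
      (formPoly fun j => (MvPolynomial.X (0, j) : MvPolynomial (Fin 2 × Fin (d + 1)) k))
      (formPoly fun j => (MvPolynomial.X (1, j) : MvPolynomial (Fin 2 × Fin (d + 1)) k))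
      d d (σ i) i) (fun _ => 1) fun i _ => key _ _
  simp only [Finset.sum_const, Finset.card_univ, Fintype.card_fin, smul_eq_mul, mul_one,
    ← two_mul] at hp
  rcases Int.units_eq_one_or (Equiv.Perm.sign σ) with h | h
  · simpa [h] using hp
  · simpa [h] using hp.neg

/-- The coordinate ring of `End_d`, the complement of the hypersurface `Res = 0` in the projective
space of dimension `2d + 1`, over an algebraically closed field `k`. Its elements are the functions
`P / Res^n` with `P` homogeneous of degree `2dn = deg (Res^n)` in the coefficients. -/
noncomputable def endCoordRing (k : Type*) [Field k] (d : ℕ) : Subalgebra k (EndLift k d → k) where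
  carrier := {g | ∃ (n : ℕ) (P : MvPolynomial (Fin 2 × Fin (d + 1)) k),
    P.IsHomogeneous (2 * d * n) ∧
      ∀ f : EndLift k d, g f = MvPolynomial.eval (fun ij => f.1 ij.1 ij.2) P / formRes f.1 ^ n}
  mul_mem' := by
    rintro a b ⟨m, P, hP, ha⟩ ⟨n, Q, hQ, hb⟩
    refine ⟨m + n, P * Q, ?_, fun f => ?_⟩
    · rw [mul_add]
      exact hP.mul hQ
    · rw [Pi.mul_apply, ha, hb, map_mul, pow_add, div_mul_div_comm]
  add_mem' := by
    rintro a b ⟨m, P, hP, ha⟩ ⟨n, Q, hQ, hb⟩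
    refine ⟨m + n, P * resPoly k d ^ n + Q * resPoly k d ^ m, ?_, fun f => ?_⟩
    · refine MvPolynomial.IsHomogeneous.add ?_ ?_
      · rw [mul_add]
        exact hP.mul ((resPoly_isHomogeneous k d).pow n)
      · rw [add_comm m n, mul_add]
        exact hQ.mul ((resPoly_isHomogeneous k d).pow m)
    · have h := f.2
      rw [Pi.add_apply, ha, hb, map_add, map_mul, map_mul, map_pow, map_pow, eval_resPoly]
      field_simp
      ring
  algebraMap_mem' r := by
    refine ⟨0, MvPolynomial.C r, ?_, fun f => ?_⟩
    · simpa using MvPolynomial.isHomogeneous_C _ r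
    · simp

/-- The ring of conjugation-invariant regular functions on `End_d`. Over an algebraically closed
field, `SL_2(k)` and `GL_2(k)` have the same image `PGL_2(k)`, so these are
the `SL_2`-invariants. -/
noncomputable def moduliCoordRing (k : Type*) [Field k] (d : ℕ) :
    Subalgebra k (EndLift k d → k) where
  carrier := {g | g ∈ endCoordRing k d ∧ ∀ f f' : EndLift k d, EndConj f f' → g f = g f'}
  mul_mem' := by
    rintro a b ⟨ha, ha'⟩ ⟨hb, hb'⟩
    refine ⟨mul_mem ha hb, fun f f' h => ?_⟩
    rw [Pi.mul_apply, Pi.mul_apply, ha' f f' h, hb' f f' h]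
  add_mem' := by
    rintro a b ⟨ha, ha'⟩ ⟨hb, hb'⟩
    refine ⟨add_mem ha hb, fun f f' h => ?_⟩
    rw [Pi.add_apply, Pi.add_apply, ha' f f' h, hb' f f' h]
  algebraMap_mem' r := ⟨Subalgebra.algebraMap_mem _ r, fun _ _ _ => rfl⟩

/-- The moduli space `M_d^1 = End_d // SL_2` over an algebraically closed field `k`: the GIT
quotient of the affine variety `End_d`, i.e. the prime spectrum (with its Zariski topology) of the
ring of invariant regular functions. -/
abbrev ModuliSpace (k : Type*) [Field k] (d : ℕ) : Type _ :=
  PrimeSpectrum (moduliCoordRing k d)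

/-- The quotient map `End_d(k) → M_d^1`: the class of `f` is the maximal ideal of the invariant
functions that vanish at `f`. -/
noncomputable def moduliPoint {k : Type*} [Field k] {d : ℕ} (f : EndLift k d) : ModuliSpace k d :=
  ⟨RingHom.ker ((Pi.evalRingHom (fun _ : EndLift k d => k) f).comp
    (moduliCoordRing k d).subtype), RingHom.ker_isPrime _⟩

/-- Base change of an endomorphism along a field extension. -/
noncomputable def EndLift.baseChange {k : Type*} [Field k] (L : Type*) [Field L] [Algebra k L]
    {d : ℕ} (f : EndLift k d) : EndLift L d :=
  ⟨fun i j => algebraMap k L (f.1 i j), by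
    rw [formRes_map]
    simpa using f.2⟩

/-- `g` extends to an endomorphism of the projective line over the ring of integers localized at
`v`: some rescaling of the pair of forms has `v`-integral coefficients and resultant a `v`-adic
unit (equivalently, the reduced forms have no common zero, so that `g` reduces to a map of the same
degree). -/
def ExtendsAt {K : Type*} [Field K] [NumberField K] {d : ℕ} (v : HeightOneSpectrum (𝓞 K))
    (g : EndLift K d) : Prop :=
  ∃ u : Kˣ, (∀ i j, v.valuation K ((u : K) * g.1 i j) ≤ 1) ∧
    v.valuation K (formRes fun i j => (u : K) * g.1 i j) = 1

/-- `f` has (simple) good reduction outside `S`: some `PGL_2(K)`-conjugate `g` of `f` extends to an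
endomorphism of the projective line over the ring of `S`-integers. Extensions are unique, hence glue,
so this means that the single map `g` extends at every prime outside `S`. -/
def HasGoodReductionOutside {K : Type*} [Field K] [NumberField K] {d : ℕ}
    (S : Set (HeightOneSpectrum (𝓞 K))) (f : EndLift K d) : Prop :=
  ∃ g : EndLift K d, EndConj f g ∧ ∀ v, v ∉ S → ExtendsAt v g

/-- The image in `M_d^1` (over the algebraic closure of `K`) of the set of degree `d` endomorphisms
of the projective line over `K` that have simple good reduction outside `S`. -/
def goodReductionImage (K : Type*) [Field K] [NumberField K] (S : Set (HeightOneSpectrum (𝓞 K)))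
    (d : ℕ) : Set (ModuliSpace (AlgebraicClosure K) d) :=
  {x | ∃ f : EndLift K d, HasGoodReductionOutside S f ∧
    x = moduliPoint (f.baseChange (AlgebraicClosure K))}

/-- The Shafarevich dimension `ShafDim_d^1[∅]` of the empty portrait: the supremum, over all number
fields `K` and all finite sets `S` of places of `K`, of the dimension of the Zariski closure in
`M_d^1` of the set of maps over `K` with simple good reduction outside `S`. Archimedean places
impose no condition, so `S` is given by its finite places. -/
noncomputable def shafDimEmpty (d : ℕ) : WithBot ℕ∞ :=
  ⨆ (K : Type) (_ : Field K) (_ : NumberField K) (S : Finset (HeightOneSpectrum (𝓞 K))),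
    topologicalKrullDim (closure (goodReductionImage K (S : Set (HeightOneSpectrum (𝓞 K))) d))

/-!
Write `f = [F : G]` with `F` constant and `G` monic of degree `d`, so that the fixed points of `f`
are the roots of `X G - F`. The maps `1 / G` with `G` integral have good reduction everywhere.
Their classes are Zariski dense among those of all maps `1 / G`, and over an algebraically closed
field `c / G` is conjugate to a map `1 / G'` by the scaling with a `(d + 1)`-st root of `c`. Hence
the closure contains the classes of all maps `c / G`, whose `d + 1` fixed points are arbitrary
nonzero numbers.

For `m = 1, …, d + 1`, the maps whose first `m` fixed points equal `1` form a rational family, so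
the closures of their images are irreducible. They decrease strictly: the number of multiple fixed
points, which is at least `m` on the `m`-th stratum if `m ≥ 2` and attains values `≤ m` on it, is
the multiplicity of `0` among the numbers `1 - λ`, with `λ` the multipliers of the fixed points.
Bounding it below is a closed condition on the moduli space, because the polynomial with the roots
`1 - λ` has invariant coefficients up to elementary factors. It is read off the resultant of `t
(F, G) + div (F, G) (X, Y)`, where the divergence commutes with linear changes of variables.
-/

section LinearSubstitution

variable {R : Type*} [CommRing R] {ι : Type*} [Fintype ι]

/-- The linear change of variables `p ↦ p(φ · X)`, substituting the `i`-th row of `φ` for `X i`. -/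
noncomputable def linearSubst (φ : Matrix ι ι R) : MvPolynomial ι R →ₐ[R] MvPolynomial ι R :=
  MvPolynomial.bind₁ fun i => ∑ j, φ i j • MvPolynomial.X j

theorem linearSubst_X (φ : Matrix ι ι R) (i : ι) :
    linearSubst φ (MvPolynomial.X i) = ∑ j, φ i j • MvPolynomial.X j :=
  MvPolynomial.bind₁_X_right _ _

theorem linearSubst_linearSubst (φ ψ : Matrix ι ι R) (p : MvPolynomial ι R) :
    linearSubst ψ (linearSubst φ p) = linearSubst (φ * ψ) p := by
  rw [← AlgHom.comp_apply]
  congr 1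
  ext1 i
  simp only [AlgHom.comp_apply, linearSubst_X, map_sum, map_smul, Matrix.mul_apply,
    Finset.sum_smul, Finset.smul_sum, smul_smul]
  exact Finset.sum_comm

theorem linearSubst_one [DecidableEq ι] : linearSubst (1 : Matrix ι ι R) = AlgHom.id R _ := by
  ext1 i
  simp [linearSubst_X, Matrix.one_apply]

theorem linearSubst_isHomogeneous {p : MvPolynomial ι R} {n : ℕ}
    (hp : p.IsHomogeneous n) (φ : Matrix ι ι R) : (linearSubst φ p).IsHomogeneous n := by
  refine (one_mul n) ▸ hp.aeval _ fun i => MvPolynomial.IsHomogeneous.sum _ _ _ fun j _ => ?_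
  rw [MvPolynomial.smul_eq_C_mul]
  exact MvPolynomial.isHomogeneous_C_mul_X _ _

theorem derivation_aeval {A σ : Type*} [Fintype σ] [CommRing A] [Algebra R A]
    (D : Derivation R A A) (ℓ : σ → A) (p : MvPolynomial σ R) :
    D (MvPolynomial.aeval ℓ p) =
      ∑ i, MvPolynomial.aeval ℓ (MvPolynomial.pderiv i p) * D (ℓ i) := by
  classical
  induction p using MvPolynomial.induction_on with
  | C a => simp
  | add p q hp hq => simp only [map_add, hp, hq, add_mul, Finset.sum_add_distrib]
  | mul_X p i hp =>
    simp only [map_mul, MvPolynomial.aeval_X, Derivation.leibniz, smul_eq_mul, hp, map_add,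
      MvPolynomial.pderiv_X, Pi.single_apply, apply_ite (MvPolynomial.aeval ℓ), map_zero, add_mul,
      mul_ite, mul_one, mul_zero, ite_mul, zero_mul, Finset.sum_add_distrib, Finset.sum_ite_eq,
      Finset.mem_univ, if_true, Finset.mul_sum, mul_assoc]

theorem pderiv_linearSubst (φ : Matrix ι ι R) (i : ι) (p : MvPolynomial ι R) :
    MvPolynomial.pderiv i (linearSubst φ p) =
      ∑ j, φ j i • linearSubst φ (MvPolynomial.pderiv j p) := by
  classical
  refine (derivation_aeval (MvPolynomial.pderiv i) _ p).trans (Finset.sum_congr rfl fun j _ => ?_)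
  simp [MvPolynomial.pderiv_X, Pi.single_apply, linearSubst, MvPolynomial.smul_eq_C_mul, mul_comm]

/-- The divergence `∑ i, ∂Fᵢ/∂Xᵢ` of a polynomial vector field. -/
noncomputable def divergence (F : ι → MvPolynomial ι R) : MvPolynomial ι R :=
  ∑ i, MvPolynomial.pderiv i (F i)

theorem divergence_isHomogeneous {F : ι → MvPolynomial ι R} {n : ℕ}
    (hF : ∀ i, (F i).IsHomogeneous n) : (divergence F).IsHomogeneous (n - 1) :=
  MvPolynomial.IsHomogeneous.sum _ _ _ fun i _ => (hF i).pderiv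

theorem linearSubst_divergence [DecidableEq ι] {F G : ι → MvPolynomial ι R} {φ : Matrix ι ι R}
    (hφ : IsUnit φ) (h : ∀ i, linearSubst φ (F i) = ∑ j, φ i j • G j) :
    linearSubst φ (divergence F) = divergence G := by
  obtain ⟨ψ, hφψ, hψφ⟩ := isUnit_iff_exists.1 hφ
  have hG (i : ι) : G i = ∑ j, ψ i j • linearSubst φ (F j) := by
    simp only [h, Finset.smul_sum, smul_smul]
    rw [Finset.sum_comm]
    simp only [← Finset.sum_smul, ← Matrix.mul_apply, hψφ, Matrix.one_apply, ite_smul, one_smul,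
      zero_smul, Finset.sum_ite_eq, Finset.mem_univ, if_true]
  symm
  calc divergence G
      = ∑ i, ∑ j, ∑ l, (φ l i * ψ i j) • linearSubst φ (MvPolynomial.pderiv l (F j)) := by
        simp only [divergence, hG, map_sum, Derivation.map_smul, pderiv_linearSubst,
          Finset.smul_sum, smul_smul, mul_comm]
    _ = ∑ j, ∑ l, (φ * ψ) l j • linearSubst φ (MvPolynomial.pderiv l (F j)) := by
        rw [Finset.sum_comm]
        refine Finset.sum_congr rfl fun j _ => ?_
        rw [Finset.sum_comm]
        simp only [Matrix.mul_apply, Finset.sum_smul]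
    _ = linearSubst φ (divergence F) := by
        simp [hφψ, Matrix.one_apply, divergence]

end LinearSubstitution

section BinaryForm

variable {R : Type*} [CommRing R] {d n : ℕ}

/-- The dehomogenization `F(X, Y) ↦ F(X, 1)`. -/
noncomputable def dehomogenize : MvPolynomial (Fin 2) R →ₐ[R] R[X] :=
  MvPolynomial.aeval ![X, 1]

theorem homogenize_dehomogenize {p : MvPolynomial (Fin 2) R} (hp : p.IsHomogeneous n) :
    (dehomogenize p).homogenize n = p :=
  homogenize_eq_of_isHomogeneous hp rfl

theorem natDegree_dehomogenize_le {p : MvPolynomial (Fin 2) R} (hp : p.IsHomogeneous n) :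
    (dehomogenize p).natDegree ≤ n := by
  rw [p.as_sum, map_sum]
  refine natDegree_sum_le_of_forall_le _ _ fun m hm => ?_
  have hmn : m 0 + m 1 = n := by
    simpa [Finsupp.weight_apply, Finsupp.sum_fintype, Fin.sum_univ_two] using
      hp (MvPolynomial.mem_support_iff.1 hm)
  rw [dehomogenize, MvPolynomial.aeval_monomial, algebraMap_eq]
  refine (natDegree_C_mul_le _ _).trans ?_
  simp only [Finsupp.prod_pow, Fin.prod_univ_two, Matrix.cons_val_zero, Matrix.cons_val_one,
    one_pow, mul_one]
  exact (natDegree_X_pow_le _).trans (by omega)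

theorem dehomogenize_pderiv_zero {p : MvPolynomial (Fin 2) R} :
    dehomogenize (MvPolynomial.pderiv 0 p) = derivative (dehomogenize p) := by
  refine ((derivation_aeval derivative' ![X, 1] p).trans ?_).symm
  simp [Fin.sum_univ_two, dehomogenize]

theorem dehomogenize_pderiv_one {p : MvPolynomial (Fin 2) R} (hp : p.IsHomogeneous n) :
    dehomogenize (MvPolynomial.pderiv 1 p) =
      C (n : R) * dehomogenize p - X * derivative (dehomogenize p) := by
  have euler := congr(dehomogenize $(hp.sum_X_mul_pderiv))
  rw [Fin.sum_univ_two, map_add, map_mul, map_mul, dehomogenize_pderiv_zero, map_nsmul,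
    nsmul_eq_mul] at euler
  simp only [dehomogenize, MvPolynomial.aeval_X, Matrix.cons_val_zero, Matrix.cons_val_one,
    one_mul] at euler ⊢
  rw [map_natCast, ← euler, add_sub_cancel_left]

/-- The binary form `∑ i, c i X^i Y^(d-i)` with coefficient vector `c`. -/
noncomputable def binaryForm : (Fin (d + 1) → R) →ₗ[R] MvPolynomial (Fin 2) R :=
  Fintype.linearCombination R fun i : Fin (d + 1) =>
    MvPolynomial.X 0 ^ (i : ℕ) * MvPolynomial.X 1 ^ (d - i)

theorem binaryForm_isHomogeneous (c : Fin (d + 1) → R) : (binaryForm c).IsHomogeneous d := by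
  refine MvPolynomial.IsHomogeneous.sum _ _ _ fun i _ => ?_
  rw [MvPolynomial.smul_eq_C_mul]
  refine MvPolynomial.IsHomogeneous.C_mul ?_ _
  simpa [Nat.add_sub_cancel' (Nat.lt_succ_iff.1 i.2)] using
    (MvPolynomial.isHomogeneous_X_pow (R := R) (0 : Fin 2) (i : ℕ)).mul
      (MvPolynomial.isHomogeneous_X_pow 1 (d - i))

theorem dehomogenize_binaryForm (c : Fin (d + 1) → R) :
    dehomogenize (binaryForm c) = formPoly c := by
  simp [dehomogenize, binaryForm, Fintype.linearCombination_apply, formPoly, smul_eq_C_mul]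

theorem natDegree_formPoly_le (c : Fin (d + 1) → R) : (formPoly c).natDegree ≤ d :=
  dehomogenize_binaryForm c ▸ natDegree_dehomogenize_le (binaryForm_isHomogeneous c)

theorem coeff_formPoly (c : Fin (d + 1) → R) (j : Fin (d + 1)) : (formPoly c).coeff j = c j := by
  rw [formPoly_coeff, dif_pos j.2]

theorem binaryForm_injective :
    Function.Injective (binaryForm : (Fin (d + 1) → R) → MvPolynomial (Fin 2) R) := by
  intro a b h
  ext j
  rw [← coeff_formPoly a, ← dehomogenize_binaryForm, h, dehomogenize_binaryForm, coeff_formPoly]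

theorem formPoly_coeff_of_natDegree_le {p : R[X]} (hp : p.natDegree ≤ d) :
    formPoly (fun j : Fin (d + 1) => p.coeff j) = p := by
  ext n
  rw [formPoly_coeff]
  split_ifs with h
  · rfl
  · exact (coeff_eq_zero_of_natDegree_lt (by omega)).symm

/-- The coefficient vector of a binary form of degree `d`. -/
noncomputable def formCoeff (d : ℕ) (p : MvPolynomial (Fin 2) R) : Fin (d + 1) → R :=
  fun j => (dehomogenize p).coeff j

theorem binaryForm_formCoeff {p : MvPolynomial (Fin 2) R} (hp : p.IsHomogeneous d) :
    binaryForm (formCoeff d p) = p := by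
  rw [← homogenize_dehomogenize (binaryForm_isHomogeneous (formCoeff d p)),
    dehomogenize_binaryForm]
  unfold formCoeff
  rw [formPoly_coeff_of_natDegree_le (natDegree_dehomogenize_le hp), homogenize_dehomogenize hp]

theorem binaryForm_formSubst (φ : Matrix (Fin 2) (Fin 2) R) (c : Fin (d + 1) → R) :
    binaryForm (formSubst φ c) = linearSubst φ (binaryForm c) := by
  rw [← binaryForm_formCoeff (linearSubst_isHomogeneous (binaryForm_isHomogeneous c) φ)]
  congr 1
  funext j
  simp [formSubst, formCoeff, dehomogenize, binaryForm, Fintype.linearCombination_apply,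
    linearSubst_X, Fin.sum_univ_two, smul_eq_C_mul, mul_assoc]

end BinaryForm

section Resultant

variable {R : Type*} [CommRing R] {d : ℕ}

/-- Linear substitution in binary forms of degree `n`, read on their dehomogenizations. -/
noncomputable def polySubst (φ : Matrix (Fin 2) (Fin 2) R) (n : ℕ) : R[X] →ₗ[R] R[X] :=
  dehomogenize.toLinearMap ∘ₗ (linearSubst φ).toLinearMap ∘ₗ homogenizeLM n

theorem natDegree_polySubst_le (φ : Matrix (Fin 2) (Fin 2) R) (n : ℕ) (p : R[X]) :
    (polySubst φ n p).natDegree ≤ n :=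
  natDegree_dehomogenize_le (linearSubst_isHomogeneous (isHomogeneous_homogenize p) φ)

theorem polySubst_mul (φ : Matrix (Fin 2) (Fin 2) R) {m n : ℕ} {p q : R[X]}
    (hp : p.natDegree ≤ m) (hq : q.natDegree ≤ n) :
    polySubst φ (m + n) (p * q) = polySubst φ m p * polySubst φ n q := by
  simp [polySubst, homogenize_mul p q hp hq]

theorem polySubst_polySubst (φ ψ : Matrix (Fin 2) (Fin 2) R) (n : ℕ) (p : R[X]) :
    polySubst ψ n (polySubst φ n p) = polySubst (φ * ψ) n p := by
  simp only [polySubst, LinearMap.comp_apply, AlgHom.toLinearMap_apply, homogenizeLM_apply,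
    homogenize_dehomogenize (linearSubst_isHomogeneous (isHomogeneous_homogenize p) φ),
    linearSubst_linearSubst]

theorem polySubst_one {n : ℕ} {p : R[X]} (hp : p.natDegree ≤ n) : polySubst 1 n p = p := by
  simpa [polySubst, linearSubst_one, dehomogenize] using aeval_homogenize_X_one p hp

theorem polySubst_formPoly (φ : Matrix (Fin 2) (Fin 2) R) (c : Fin (d + 1) → R) :
    polySubst φ d (formPoly c) = formPoly (formSubst φ c) := by
  simp only [polySubst, LinearMap.comp_apply, AlgHom.toLinearMap_apply, homogenizeLM_apply]
  rw [← dehomogenize_binaryForm, homogenize_dehomogenize (binaryForm_isHomogeneous c),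
    ← binaryForm_formSubst, dehomogenize_binaryForm]

theorem natDegree_le_of_mem_degreeLT {n : ℕ} {p : R[X]} (hp : p ∈ degreeLT R (n + 1)) :
    p.natDegree ≤ n := by
  rw [degreeLT_succ_eq_degreeLE, mem_degreeLE] at hp
  exact natDegree_le_of_degree_le hp

/-- The right action of matrices on polynomials of degree at most `n` by linear substitution. -/
noncomputable def substAction (n : ℕ) :
    Matrix (Fin 2) (Fin 2) R →* (Module.End R (degreeLT R (n + 1)))ᵐᵒᵖ where
  toFun φ := .op <| (polySubst φ n).restrict fun p _ => by
    rw [degreeLT_succ_eq_degreeLE, mem_degreeLE]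
    exact degree_le_of_natDegree_le (natDegree_polySubst_le φ n p)
  map_one' := MulOpposite.unop_injective <| LinearMap.ext fun p =>
    Subtype.ext (polySubst_one (natDegree_le_of_mem_degreeLT p.2))
  map_mul' φ ψ := MulOpposite.unop_injective <| LinearMap.ext fun p =>
    Subtype.ext (polySubst_polySubst φ ψ n p).symm

/-- The right action of matrices on `M × M` with
`(f₀, f₁) · pairAction ψ (p, q) = (ψ (f₀, f₁)) · (p, q)` for the pairing
`(f₀, f₁) · (p, q) = f₀ q + f₁ p` that defines `Polynomial.sylvesterMap`. -/
def pairAction (M : Type*) [AddCommGroup M] [Module R M] :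
    Matrix (Fin 2) (Fin 2) R →* (Module.End R (M × M))ᵐᵒᵖ where
  toFun ψ := .op <| LinearMap.prod
    (ψ 1 1 • LinearMap.fst R M M + ψ 0 1 • LinearMap.snd R M M)
    (ψ 1 0 • LinearMap.fst R M M + ψ 0 0 • LinearMap.snd R M M)
  map_one' := MulOpposite.unop_injective <| LinearMap.ext fun pq => by simp
  map_mul' ψ χ := MulOpposite.unop_injective <| LinearMap.ext fun pq => by
    ext1 <;> simp [Matrix.mul_apply, Fin.sum_univ_two] <;> module

/-- The map `(p, q) ↦ F q + G p`, with `(F, G)` the pair of forms `c`, whose determinant is the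
resultant of the pair. -/
noncomputable def formSylvester (c : Fin 2 → Fin (d + 1) → R) :
    degreeLT R d × degreeLT R d →ₗ[R] degreeLT R (d + d) :=
  sylvesterMap (formPoly (c 0)) (formPoly (c 1))
    (natDegree_formPoly_le _) (natDegree_formPoly_le _)

theorem det_toMatrix_formSylvester (c : Fin 2 → Fin (d + 1) → R) :
    (LinearMap.toMatrix (((degreeLT.basis R d).prod (degreeLT.basis R d)).reindex finSumFinEquiv)
      (degreeLT.basis R (d + d)) (formSylvester c)).det = formRes c := by
  rw [formSylvester, toMatrix_sylvesterMap', formRes, resultant]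

theorem exists_formRes_eq_of_formSylvester_comp {e : Module.End R (degreeLT R d × degreeLT R d)}
    {e' : Module.End R (degreeLT R (d + d))} (he : IsUnit e) (he' : IsUnit e') :
    ∃ ω : Rˣ, ∀ a b : Fin 2 → Fin (d + 1) → R,
      formSylvester b ∘ₗ e = e' ∘ₗ formSylvester a → formRes b = ω * formRes a := by
  refine ⟨(he'.map LinearMap.det).unit * (he.map LinearMap.det).unit⁻¹, fun a b h => ?_⟩
  let B := ((degreeLT.basis R d).prod (degreeLT.basis R d)).reindex finSumFinEquiv
  have := congr((LinearMap.toMatrix B (degreeLT.basis R (d + d)) $h).det)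
  rw [LinearMap.toMatrix_comp B B, LinearMap.toMatrix_comp B (degreeLT.basis R (d + d)),
    Matrix.det_mul, Matrix.det_mul, det_toMatrix_formSylvester, det_toMatrix_formSylvester,
    LinearMap.det_toMatrix, LinearMap.det_toMatrix] at this
  rw [Units.val_mul, mul_right_comm, Units.eq_mul_inv_iff_mul_eq]
  exact this

theorem formPoly_sum_smul (a : Fin 2 → R) (c : Fin 2 → Fin (d + 1) → R) :
    formPoly (∑ j, a j • c j) = ∑ j, C (a j) * formPoly (c j) := by
  simp only [← dehomogenize_binaryForm, map_sum, map_smul, smul_eq_C_mul]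

theorem exists_formRes_eq_of_formSubst_eq {φ ψ : Matrix (Fin 2) (Fin 2) R} (hφ : IsUnit φ)
    (hψ : IsUnit ψ) (d : ℕ) :
    ∃ ω : Rˣ, ∀ a b : Fin 2 → Fin (d + 1) → R,
      (∀ i, formSubst φ (a i) = ∑ j, ψ i j • b j) → formRes b = ω * formRes a := by
  rcases d with _ | n
  · exact ⟨1, fun a b _ => by simp [formRes]⟩
  let ρ := (substAction n φ).unop
  have hρ : IsUnit ρ := (hφ.map (substAction n)).unop
  have he : IsUnit ((pairAction (degreeLT R (n + 1)) ψ).unop * ρ.prodMap ρ) :=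
    (hψ.map (pairAction _)).unop.mul
      ((Prod.isUnit_iff.2 ⟨hρ, hρ⟩ : IsUnit (ρ, ρ)).map (LinearMap.prodMapRingHom R _ _))
  have he' : IsUnit (substAction (n + 1 + n) φ).unop := (hφ.map (substAction _)).unop
  obtain ⟨ω, hω⟩ := exists_formRes_eq_of_formSylvester_comp he he'
  refine ⟨ω, fun a b h => hω a b (LinearMap.ext fun ⟨p, q⟩ => Subtype.ext ?_)⟩
  have hp := natDegree_le_of_mem_degreeLT p.2
  have hq := natDegree_le_of_mem_degreeLT q.2
  change formPoly (b 0) * (ψ 1 0 • polySubst φ n p + ψ 0 0 • polySubst φ n q) +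
      formPoly (b 1) * (ψ 1 1 • polySubst φ n p + ψ 0 1 • polySubst φ n q) =
    polySubst φ (n + 1 + n) (formPoly (a 0) * q + formPoly (a 1) * p)
  rw [map_add, polySubst_mul φ (natDegree_formPoly_le _) hq,
    polySubst_mul φ (natDegree_formPoly_le _) hp, polySubst_formPoly, polySubst_formPoly,
    h, h, formPoly_sum_smul (ψ 0), formPoly_sum_smul (ψ 1)]
  simp only [Fin.sum_univ_two, smul_eq_C_mul]
  ring

end Resultant

section DivTwist

variable {R S : Type*} [CommRing R] [CommRing S] {d : ℕ} {k : Type*} [Field k]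

theorem coeff_X_mul_derivative (p : R[X]) (n : ℕ) :
    (X * derivative p).coeff n = n * p.coeff n := by
  rcases n with _ | n
  · simp
  · rw [coeff_X_mul, coeff_derivative, mul_comm, Nat.cast_succ]

/-- The pair of forms `t • (F, G) + div (F, G) • (X, Y)` attached to a pair of forms `(F, G)`. It
vanishes at a fixed point of multiplier `λ` exactly when `t + d + 1 = 1 - λ`. -/
noncomputable def divTwist (t : R) (c : Fin 2 → Fin (d + 1) → R) : Fin 2 → Fin (d + 1) → R :=
  fun i => formCoeff d <|
    t • binaryForm (c i) + MvPolynomial.X i * divergence fun j => binaryForm (c j)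

theorem X_mul_divergence_isHomogeneous (c : Fin 2 → Fin (d + 1) → R) (i : Fin 2) :
    (MvPolynomial.X i * divergence fun j => binaryForm (c j)).IsHomogeneous d := by
  rcases d with _ | n
  · simpa [divergence, binaryForm, Fintype.linearCombination_apply] using
      MvPolynomial.isHomogeneous_zero (Fin 2) R 0
  · have h : (MvPolynomial.X i * divergence fun j => binaryForm (c j)).IsHomogeneous (1 + n) :=
      (MvPolynomial.isHomogeneous_X R i).mul
        (divergence_isHomogeneous fun j => binaryForm_isHomogeneous (c j))
    rwa [Nat.add_comm 1 n] at h

theorem binaryForm_divTwist (t : R) (c : Fin 2 → Fin (d + 1) → R) (i : Fin 2) :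
    binaryForm (divTwist t c i) =
      t • binaryForm (c i) + MvPolynomial.X i * divergence fun j => binaryForm (c j) := by
  refine binaryForm_formCoeff (MvPolynomial.IsHomogeneous.add ?_
    (X_mul_divergence_isHomogeneous c i))
  rw [MvPolynomial.smul_eq_C_mul]
  exact (binaryForm_isHomogeneous (c i)).C_mul t

theorem formPoly_divTwist (t : R) (c : Fin 2 → Fin (d + 1) → R) (i : Fin 2) :
    formPoly (divTwist t c i) = C t * formPoly (c i) + ![X, 1] i *
      (derivative (formPoly (c 0)) +
        (C (d : R) * formPoly (c 1) - X * derivative (formPoly (c 1)))) := by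
  rw [← dehomogenize_binaryForm, binaryForm_divTwist, divergence, Fin.sum_univ_two, map_add,
    map_smul, map_mul, map_add, dehomogenize_pderiv_zero,
    dehomogenize_pderiv_one (binaryForm_isHomogeneous (c 1)), smul_eq_C_mul]
  simp only [dehomogenize_binaryForm]
  simp only [dehomogenize, MvPolynomial.aeval_X]

theorem divTwist_map (h : R →+* S) (t : R) (c : Fin 2 → Fin (d + 1) → R) :
    divTwist (h t) (fun i j => h (c i j)) = fun i j => h (divTwist t c i j) := by
  funext i j
  rw [← coeff_formPoly (divTwist t c i), ← coeff_formPoly (divTwist (h t) _ i), ← coeff_map]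
  simp only [formPoly_divTwist, ← formPoly_map, Polynomial.map_add, Polynomial.map_mul,
    Polynomial.map_sub, map_C, map_X, derivative_map]
  fin_cases i <;> simp

theorem divTwist_X_isHomogeneous (t : k) (i : Fin 2) (j : Fin (d + 1)) :
    (divTwist (MvPolynomial.C t)
      (fun i j => (MvPolynomial.X (i, j) : MvPolynomial (Fin 2 × Fin (d + 1)) k)) i
      j).IsHomogeneous 1 := by
  let P (a : Fin 2) := formPoly fun j : Fin (d + 1) =>
    (MvPolynomial.X (a, j) : MvPolynomial (Fin 2 × Fin (d + 1)) k)
  have hP (a : Fin 2) (n : ℕ) (r : k) : (MvPolynomial.C r * (P a).coeff n).IsHomogeneous 1 :=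
    (formPoly_coeff_isHomogeneous a n).C_mul r
  have hdiv (n : ℕ) : ((derivative (P 0) + (C (d : MvPolynomial (Fin 2 × Fin (d + 1)) k) * P 1 -
      X * derivative (P 1))).coeff n).IsHomogeneous 1 := by
    rw [coeff_add, coeff_sub, coeff_X_mul_derivative, coeff_derivative, coeff_C_mul,
      ← Nat.cast_succ, mul_comm]
    refine .add ?_ (.sub ?_ ?_)
    · simpa only [map_natCast] using hP 0 (n + 1) (n + 1 : ℕ)
    · simpa only [map_natCast] using hP 1 n d
    · simpa only [map_natCast] using hP 1 n n
  rw [← coeff_formPoly (divTwist _ _ i), formPoly_divTwist, coeff_add, coeff_C_mul]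
  refine (hP i j t).add ?_
  fin_cases i
  · rcases j with ⟨_ | j, _⟩
    · simpa using MvPolynomial.isHomogeneous_zero _ k 1
    · simpa using hdiv j
  · simpa using hdiv j

theorem formSubst_divTwist {f g : Fin 2 → Fin (d + 1) → R} {φ : Matrix (Fin 2) (Fin 2) R}
    (hφ : IsUnit φ) {u : R} (h : ∀ i, formSubst φ (f i) = u • ∑ j, φ i j • g j) (t : R)
    (i : Fin 2) : formSubst φ (divTwist t f i) = u • ∑ j, φ i j • divTwist t g j := by
  have hform (i : Fin 2) :
      linearSubst φ (binaryForm (f i)) = ∑ j, φ i j • u • binaryForm (g j) := by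
    rw [← binaryForm_formSubst, h, map_smul, map_sum, Finset.smul_sum]
    simp only [map_smul, smul_comm u]
  have hdiv : linearSubst φ (divergence fun i => binaryForm (f i)) =
      u • divergence fun j => binaryForm (g j) := by
    rw [linearSubst_divergence hφ hform]
    simp only [divergence, Derivation.map_smul, Finset.smul_sum]
  refine binaryForm_injective ?_
  simp only [binaryForm_formSubst, binaryForm_divTwist, map_add, map_smul, map_mul,
    linearSubst_X, hform, hdiv, Fin.sum_univ_two, add_mul, smul_mul_assoc, mul_smul_comm]
  module

theorem formRes_divTwist_mul_formRes {f g : Fin 2 → Fin (d + 1) → R}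
    {φ : Matrix (Fin 2) (Fin 2) R} (hφ : IsUnit φ) {u : R} (hu : IsUnit u)
    (h : ∀ i, formSubst φ (f i) = u • ∑ j, φ i j • g j) (t : R) :
    formRes (divTwist t f) * formRes g = formRes (divTwist t g) * formRes f := by
  obtain ⟨ω, hω⟩ := exists_formRes_eq_of_formSubst_eq hφ ((isUnit_smul_iff hu.unit φ).2 hφ) d
  have hres {a b : Fin 2 → Fin (d + 1) → R}
      (hab : ∀ i, formSubst φ (a i) = u • ∑ j, φ i j • b j) : formRes b = ω * formRes a :=
    hω a b fun i => by simp [hab i, Units.smul_def, smul_smul]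
  rw [hres h, hres (formSubst_divTwist hφ h t)]
  ring

end DivTwist

section Invariants

theorem exists_coeff_eq_sum_eval (k : Type*) [Field k] [Infinite k] (N j : ℕ) :
    ∃ (s : Finset k) (w : k → k), ∀ p : k[X], p.natDegree ≤ N →
      p.coeff j = ∑ x ∈ s, w x * p.eval x := by
  classical
  obtain ⟨s, -, hs⟩ := Set.infinite_univ (α := k).exists_subset_card_eq (N + 1)
  refine ⟨s, fun x => (Lagrange.basis s id x).coeff j, fun p hp => ?_⟩
  have hdeg : p.degree < s.card :=
    (degree_le_of_natDegree_le hp).trans_lt (by rw [hs]; exact_mod_cast Nat.lt_succ_self N)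
  conv_lhs => rw [Lagrange.eq_interpolate Function.injective_id.injOn hdeg]
  simp [Lagrange.interpolate_apply, finsetSum_coeff, mul_comm]

/-- The polynomial in `s` whose value is, up to a power of `s - (d + 1)` and the resultant of the
pair, the product of `s - (1 - λ)` over the multipliers `λ` of the fixed points. -/
noncomputable def multiplierPoly {R : Type*} [CommRing R] {d : ℕ} (c : Fin 2 → Fin (d + 1) → R) :
    R[X] :=
  formRes (divTwist (X - C (d + 1 : R)) fun i j => C (c i j))

theorem multiplierPoly_map {R S : Type*} [CommRing R] [CommRing S] {d : ℕ} (h : R →+* S)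
    (c : Fin 2 → Fin (d + 1) → R) :
    multiplierPoly (fun i j => h (c i j)) = (multiplierPoly c).map h := by
  rw [multiplierPoly, multiplierPoly, ← coe_mapRingHom, ← formRes_map, ← divTwist_map]
  simp

theorem eval_multiplierPoly {R : Type*} [CommRing R] {d : ℕ} (c : Fin 2 → Fin (d + 1) → R)
    (s : R) : (multiplierPoly c).eval s = formRes (divTwist (s - (d + 1)) c) := by
  rw [multiplierPoly, ← coe_evalRingHom, ← formRes_map, ← divTwist_map]
  simp

variable {k : Type*} [Field k] {d : ℕ}

theorem natDegree_multiplierPoly_le (c : Fin 2 → Fin (d + 1) → k) :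
    (multiplierPoly c).natDegree ≤ (multiplierPoly fun (i : Fin 2) (j : Fin (d + 1)) =>
      (MvPolynomial.X (i, j) : MvPolynomial (Fin 2 × Fin (d + 1)) k)).natDegree := by
  have hmap := multiplierPoly_map (MvPolynomial.eval fun ij => c ij.1 ij.2)
    fun (i : Fin 2) (j : Fin (d + 1)) => (MvPolynomial.X (i, j) : MvPolynomial _ k)
  simp only [MvPolynomial.eval_X] at hmap
  rw [hmap]
  exact natDegree_map_le

theorem formRes_divTwist_div_formRes_mem (k : Type*) [Field k] (d : ℕ) (t : k) :
    (fun f : EndLift k d => formRes (divTwist t f.1) / formRes f.1) ∈ moduliCoordRing k d := by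
  let T : Fin 2 × Fin (d + 1) → MvPolynomial (Fin 2 × Fin (d + 1)) k := fun ij =>
    divTwist (MvPolynomial.C t) (fun i j => MvPolynomial.X (i, j)) ij.1 ij.2
  refine ⟨⟨1, MvPolynomial.bind₁ T (resPoly k d), ?_, fun f => ?_⟩, ?_⟩
  · simpa using (resPoly_isHomogeneous k d).aeval T fun ij => divTwist_X_isHomogeneous t ij.1 ij.2
  · have hT : (fun ij => MvPolynomial.eval (fun ij => f.1 ij.1 ij.2) (T ij)) =
        fun ij => divTwist t f.1 ij.1 ij.2 := by
      funext ij
      simpa using congr($(divTwist_map (MvPolynomial.eval fun ij => f.1 ij.1 ij.2)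
        (MvPolynomial.C t) fun i j => MvPolynomial.X (i, j)) ij.1 ij.2).symm
    have hR : MvPolynomial.eval (fun ij => f.1 ij.1 ij.2) (MvPolynomial.bind₁ T (resPoly k d)) =
        formRes (divTwist t f.1) := by
      rw [← eval_resPoly, ← hT]
      exact MvPolynomial.aeval_bind₁ _ T (resPoly k d)
    simp only [hR, pow_one]
  · rintro f g ⟨φ, u, h⟩
    rw [div_eq_div_iff f.2 g.2]
    exact formRes_divTwist_mul_formRes φ.isUnit u.isUnit h t

/-- The coefficients of `multiplierPoly`, normalized by the resultant, as functions on `End_d`. -/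
noncomputable def multiplierCoeff (k : Type*) [Field k] (d j : ℕ) (f : EndLift k d) : k :=
  (multiplierPoly f.1).coeff j / formRes f.1

theorem multiplierCoeff_mem [Infinite k] (d j : ℕ) :
    multiplierCoeff k d j ∈ moduliCoordRing k d := by
  obtain ⟨s, w, hw⟩ := exists_coeff_eq_sum_eval k (multiplierPoly fun (i : Fin 2)
    (j : Fin (d + 1)) => (MvPolynomial.X (i, j) : MvPolynomial _ k)).natDegree j
  have : multiplierCoeff k d j = ∑ x ∈ s, w x • fun f : EndLift k d =>
      formRes (divTwist (x - (d + 1)) f.1) / formRes f.1 := by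
    funext f
    simp [multiplierCoeff, hw _ (natDegree_multiplierPoly_le f.1), eval_multiplierPoly,
      Finset.sum_div, mul_div_assoc]
  rw [this]
  exact sum_mem fun x _ => Subalgebra.smul_mem _ (formRes_divTwist_div_formRes_mem k d _) _

end Invariants

section ReciprocalMaps

variable {R S : Type*} [CommRing R] [CommRing S] {d : ℕ} {k : Type*} [Field k]

/-- The pair of forms `c Y^d` and `X^d + b_{d-1} X^{d-1} Y + ⋯ + b_0 Y^d`. -/
def recipFamily (c : R) (b : Fin d → R) : Fin 2 → Fin (d + 1) → R :=
  ![Pi.single 0 c, Fin.snoc b 1]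

theorem recipFamily_map (h : R →+* S) (c : R) (b : Fin d → R) :
    (fun i j => h (recipFamily c b i j)) = recipFamily (h c) fun j => h (b j) := by
  funext i j
  fin_cases i
  · simp [recipFamily, Pi.single_apply, apply_ite h]
  · refine Fin.lastCases ?_ (fun j => ?_) j <;> simp [recipFamily]

theorem formPoly_recipFamily_zero (c : R) (b : Fin d → R) :
    formPoly (recipFamily c b 0) = C c := by
  simp [recipFamily, formPoly, Pi.single_apply, apply_ite C]

theorem coeff_formPoly_recipFamily_one (c : R) (b : Fin d → R) :
    (formPoly (recipFamily c b 1)).coeff d = 1 :=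
  (coeff_formPoly (recipFamily c b 1) (Fin.last d)).trans (Fin.snoc_last (α := fun _ => R) 1 b)

theorem formRes_recipFamily (c : R) (b : Fin d → R) :
    formRes (recipFamily c b) = (-1) ^ (d * d) * c ^ d := by
  rw [formRes, formPoly_recipFamily_zero, resultant_C_left, coeff_formPoly_recipFamily_one,
    one_pow, mul_one]

theorem formRes_recipFamily_ne_zero [IsDomain R] {c : R} (hc : c ≠ 0) (b : Fin d → R) :
    formRes (recipFamily c b) ≠ 0 := by
  rw [formRes_recipFamily]
  exact mul_ne_zero (pow_ne_zero _ (neg_ne_zero.2 one_ne_zero)) (pow_ne_zero _ hc)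

theorem formSubst_one (c : Fin (d + 1) → R) : formSubst 1 c = c :=
  binaryForm_injective <| by rw [binaryForm_formSubst, linearSubst_one, AlgHom.id_apply]

theorem endConj_refl (f : EndLift k d) : EndConj f f :=
  ⟨1, 1, fun i => by simp [formSubst_one, Matrix.one_apply]⟩

theorem formSubst_diagonal (a : R) (c : Fin (d + 1) → R) :
    formSubst (Matrix.diagonal ![a, 1]) c = fun j : Fin (d + 1) => a ^ (j : ℕ) * c j := by
  funext j
  rw [← coeff_formPoly (fun j : Fin (d + 1) => a ^ (j : ℕ) * c j)]
  simp [formSubst, formPoly, mul_pow, mul_assoc, mul_left_comm]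

theorem endConj_recipFamily {f g : EndLift k d} {a : k} (ha : a ≠ 0) {b : Fin d → k}
    (hf : f.1 = recipFamily (a ^ (d + 1)) b)
    (hg : g.1 = recipFamily 1 fun j => a ^ (j : ℕ) * b j / a ^ d) : EndConj f g := by
  let φ : GL (Fin 2) k := Matrix.GeneralLinearGroup.mkOfDetNeZero (Matrix.diagonal ![a, 1])
    (by simpa [Matrix.det_diagonal] using ha)
  have hφ : (φ : Matrix (Fin 2) (Fin 2) k) = Matrix.diagonal ![a, 1] := rfl
  refine ⟨φ, Units.mk0 (a ^ d) (pow_ne_zero d ha), Fin.forall_fin_two.2 ⟨?_, ?_⟩⟩ <;>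
    simp only [hφ, hf, hg, formSubst_diagonal, Fin.sum_univ_two, Units.val_mk0] <;> funext j
  · refine Fin.cases ?_ (fun j => ?_) j
    · simp [recipFamily, pow_succ]
    · simp [recipFamily, Fin.succ_ne_zero]
  · refine Fin.lastCases ?_ (fun j => ?_) j
    · simp [recipFamily]
    · simp [recipFamily, mul_div_cancel₀ _ (pow_ne_zero d ha)]

end ReciprocalMaps

section PrescribedFixedPoints

open scoped Finset

variable {R S : Type*} [CommRing R] [CommRing S] {d n : ℕ}

theorem resultant_nodal_left (r : Fin n → R) {q : R[X]} {m : ℕ} (hq : q.natDegree ≤ m) :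
    resultant (Lagrange.nodal Finset.univ r) q n m = ∏ i, q.eval (r i) := by
  nontriviality R
  have h := resultant_prod_left Finset.univ (fun i => X - C (r i)) q m (by simp) hq
  rw [← Lagrange.nodal_eq, Lagrange.natDegree_nodal, Finset.card_fin] at h
  exact h.trans <| Finset.prod_congr rfl fun i _ => by
    rw [natDegree_X_sub_C, resultant_X_sub_C_left _ _ _ hq]

theorem coeff_mul_resultant_of_sub_mul_X_eq {p q : R[X]} (hp : p.natDegree ≤ d)
    (hq : q.natDegree ≤ d) {a : R} {r : Fin (d + 1) → R}
    (h : q * X - p = C a * Lagrange.nodal Finset.univ r) :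
    q.coeff d * resultant p q d d = a ^ d * ∏ i, q.eval (r i) := by
  have hsucc := resultant_succ_left_deg p q d d hp
  have hp' : p = C (-a) * Lagrange.nodal Finset.univ r + q * X := by
    rw [C_neg, neg_mul, ← h]
    ring
  have hX : (X : R[X]).natDegree + d ≤ d + 1 := by
    rw [add_comm]
    exact Nat.add_le_add_left natDegree_X_le d
  conv_lhs at hsucc => rw [hp', resultant_add_mul_left _ _ _ _ _ hX hq, resultant_C_mul_left,
    resultant_nodal_left r hq, neg_pow, mul_assoc]
  rw [mul_assoc] at hsucc
  exact ((isUnit_one.neg.pow d).mul_left_cancel hsucc).symm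

/-- The pair of forms `(c Y^d, G)` such that `X G - c` has the roots `r i`. -/
noncomputable def rootFamily (r : Fin (d + 1) → R) : Fin 2 → Fin (d + 1) → R :=
  recipFamily (-(Lagrange.nodal Finset.univ r).coeff 0) fun j =>
    (Lagrange.nodal Finset.univ r).coeff (j + 1)

theorem nodal_map (h : R →+* S) (r : Fin n → R) :
    (Lagrange.nodal Finset.univ r).map h = Lagrange.nodal Finset.univ fun i => h (r i) := by
  simp [Lagrange.nodal, Polynomial.map_prod]

theorem rootFamily_map (h : R →+* S) (r : Fin (d + 1) → R) :
    (fun i j => h (rootFamily r i j)) = rootFamily fun i => h (r i) := by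
  rw [rootFamily, recipFamily_map, rootFamily, ← nodal_map]
  simp

theorem formPoly_rootFamily_one (r : Fin (d + 1) → R) :
    formPoly (rootFamily r 1) = (Lagrange.nodal Finset.univ r).divX := by
  nontriviality R
  ext n
  rw [coeff_divX, formPoly_coeff]
  split_ifs with hn
  · rcases (Nat.lt_succ_iff.1 hn).eq_or_lt with rfl | h
    · have hmonic := (Lagrange.nodal_monic (s := Finset.univ) (v := r)).coeff_natDegree
      rw [Lagrange.natDegree_nodal, Finset.card_fin] at hmonic
      exact (Fin.snoc_last (n := n) (α := fun _ => R) 1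
        fun j => (Lagrange.nodal Finset.univ r).coeff (j + 1)).trans hmonic.symm
    · exact Fin.snoc_castSucc (α := fun _ => R) _
        (fun j : Fin d => (Lagrange.nodal Finset.univ r).coeff (j + 1)) ⟨n, h⟩
  · refine (coeff_eq_zero_of_natDegree_lt ?_).symm
    rw [Lagrange.natDegree_nodal, Finset.card_fin]
    omega

theorem formPoly_rootFamily_one_mul_X_sub (r : Fin (d + 1) → R) :
    formPoly (rootFamily r 1) * X - formPoly (rootFamily r 0) = Lagrange.nodal Finset.univ r := by
  rw [formPoly_rootFamily_one, rootFamily, formPoly_recipFamily_zero, C_neg, sub_neg_eq_add,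
    divX_mul_X_add]

theorem coeff_nodal_zero (r : Fin n → R) :
    (Lagrange.nodal Finset.univ r).coeff 0 = ∏ i, -r i := by
  simp [coeff_zero_eq_eval_zero, Lagrange.eval_nodal]

theorem formRes_rootFamily_ne_zero [IsDomain R] {r : Fin (d + 1) → R} (hr : ∀ i, r i ≠ 0) :
    formRes (rootFamily r) ≠ 0 := by
  refine formRes_recipFamily_ne_zero (neg_ne_zero.2 ?_) _
  rw [coeff_nodal_zero]
  exact Finset.prod_ne_zero_iff.2 fun i _ => neg_ne_zero.2 (hr i)

theorem mul_formRes_divTwist_rootFamily (t : R) (r : Fin (d + 1) → R) :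
    t * formRes (divTwist t (rootFamily r)) = t ^ d * ∏ i,
      ((t + (d + 1)) * (formPoly (rootFamily r 1)).eval (r i) -
        (derivative (Lagrange.nodal Finset.univ r)).eval (r i)) := by
  have hΦ := formPoly_rootFamily_one_mul_X_sub r
  have hF : derivative (formPoly (rootFamily r 0)) = 0 := by
    rw [rootFamily, formPoly_recipFamily_zero, derivative_C]
  let F := formPoly (rootFamily r 0)
  let G := formPoly (rootFamily r 1)
  have hGd : G.coeff d = 1 := coeff_formPoly_recipFamily_one _ _
  have hp : formPoly (divTwist t (rootFamily r) 0) = C t * F +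
      X * (C (d : R) * G - X * derivative G) := by
    simp only [formPoly_divTwist, hF, zero_add, Matrix.cons_val_zero, F, G]
  have hq : formPoly (divTwist t (rootFamily r) 1) = C t * G +
      (C (d : R) * G - X * derivative G) := by
    simp only [formPoly_divTwist, hF, zero_add, Matrix.cons_val_one,
      Matrix.cons_val_fin_one, one_mul, G]
  have hlead : (formPoly (divTwist t (rootFamily r) 1)).coeff d = t := by
    rw [hq, coeff_add, coeff_sub, coeff_X_mul_derivative, coeff_C_mul, coeff_C_mul, hGd]
    ring
  have hres := coeff_mul_resultant_of_sub_mul_X_eq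
    (natDegree_formPoly_le (divTwist t (rootFamily r) 0))
    (natDegree_formPoly_le (divTwist t (rootFamily r) 1)) (a := t) (r := r)
    (by rw [← hΦ, hp, hq]; ring)
  rw [hlead] at hres
  refine hres.trans (congrArg _ (Finset.prod_congr rfl fun i _ => ?_))
  rw [hq, ← hΦ]
  simp [hF]
  ring

theorem mul_multiplierPoly_rootFamily (r : Fin (d + 1) → R) :
    (X - C (d + 1 : R)) * multiplierPoly (rootFamily r) = (X - C (d + 1 : R)) ^ d *
      ∏ i, (C ((formPoly (rootFamily r 1)).eval (r i)) * X -
        C ((derivative (Lagrange.nodal Finset.univ r)).eval (r i))) := by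
  rw [multiplierPoly, rootFamily_map, mul_formRes_divTwist_rootFamily]
  refine congrArg _ (Finset.prod_congr rfl fun i _ => ?_)
  rw [← rootFamily_map, ← formPoly_map, ← nodal_map, derivative_map, eval_map, eval_map,
    eval₂_at_apply, eval₂_at_apply]
  simp only [map_add, map_one, map_natCast, sub_add_cancel, mul_comm]

theorem natTrailingDegree_prod [IsDomain R] {ι : Type*} (s : Finset ι) {p : ι → R[X]}
    (hp : ∀ i ∈ s, p i ≠ 0) :
    (∏ i ∈ s, p i).natTrailingDegree = ∑ i ∈ s, (p i).natTrailingDegree := by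
  induction s using Finset.cons_induction with
  | empty => simp
  | cons i s hi ih =>
    rw [Finset.forall_mem_cons] at hp
    rw [Finset.prod_cons, Finset.sum_cons,
      natTrailingDegree_mul hp.1 (Finset.prod_ne_zero_iff.2 hp.2), ih hp.2]

theorem C_mul_X_sub_C_ne_zero {a : R} (ha : a ≠ 0) (b : R) : C a * X - C b ≠ 0 := fun h =>
  ha (by simpa using congr(($h).coeff 1))

theorem natTrailingDegree_C_mul_X_sub_C [IsDomain R] {a : R} (ha : a ≠ 0) (b : R)
    [Decidable (b = 0)] :
    (C a * X - C b).natTrailingDegree = if b = 0 then 1 else 0 := by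
  split_ifs with hb
  · rw [hb, C_0, sub_zero, natTrailingDegree_mul (C_ne_zero.2 ha) X_ne_zero, natTrailingDegree_C,
      natTrailingDegree_X]
  · exact natTrailingDegree_eq_zero.2 (.inr (by simpa using hb))

theorem eval_formPoly_rootFamily_one_ne_zero [IsDomain R] {r : Fin (d + 1) → R}
    (hr : ∀ i, r i ≠ 0) (i : Fin (d + 1)) : (formPoly (rootFamily r 1)).eval (r i) ≠ 0 := by
  intro h
  have hΦ := congr(($(formPoly_rootFamily_one_mul_X_sub r)).eval (r i))
  rw [eval_sub, eval_mul, h, zero_mul, Lagrange.eval_nodal_at_node (Finset.mem_univ i), zero_sub,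
    neg_eq_zero, rootFamily, formPoly_recipFamily_zero, eval_C, neg_eq_zero, coeff_nodal_zero,
    Finset.prod_eq_zero_iff] at hΦ
  obtain ⟨j, -, hj⟩ := hΦ
  exact hr j (neg_eq_zero.1 hj)

theorem eval_derivative_nodal_eq_zero_iff [IsDomain R] {r : Fin n → R} {i : Fin n} :
    (derivative (Lagrange.nodal Finset.univ r)).eval (r i) = 0 ↔ ∃ j ≠ i, r j = r i := by
  rw [Lagrange.eval_nodal_derivative_eval_node_eq (Finset.mem_univ i), Lagrange.eval_nodal,
    Finset.prod_eq_zero_iff]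
  simp [sub_eq_zero, eq_comm]

theorem multiplierPoly_rootFamily_ne_zero [IsDomain R] {r : Fin (d + 1) → R}
    (hr : ∀ i, r i ≠ 0) : multiplierPoly (rootFamily r) ≠ 0 := by
  refine right_ne_zero_of_mul (a := X - C (d + 1 : R)) ?_
  rw [mul_multiplierPoly_rootFamily]
  exact mul_ne_zero (pow_ne_zero d (X_sub_C_ne_zero _)) <| Finset.prod_ne_zero_iff.2 fun i _ =>
    C_mul_X_sub_C_ne_zero (eval_formPoly_rootFamily_one_ne_zero hr i) _

theorem natTrailingDegree_multiplierPoly_rootFamily [IsDomain R] [CharZero R]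
    {r : Fin (d + 1) → R} (hr : ∀ i, r i ≠ 0) [DecidablePred fun i => ∃ j ≠ i, r j = r i] :
    (multiplierPoly (rootFamily r)).natTrailingDegree = #{i | ∃ j ≠ i, r j = r i} := by
  classical
  let t : R[X] := X - C (d + 1 : R)
  let p (i : Fin (d + 1)) : R[X] := C ((formPoly (rootFamily r 1)).eval (r i)) * X -
    C ((derivative (Lagrange.nodal Finset.univ r)).eval (r i))
  have hp (i : Fin (d + 1)) : p i ≠ 0 :=
    C_mul_X_sub_C_ne_zero (eval_formPoly_rootFamily_one_ne_zero hr i) _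
  have hprod : t ^ 1 * multiplierPoly (rootFamily r) = t ^ d * ∏ i, p i := by
    rw [pow_one]
    exact mul_multiplierPoly_rootFamily r
  have ht (m : ℕ) : t ^ m ≠ 0 := pow_ne_zero m (X_sub_C_ne_zero _)
  have htd (m : ℕ) : (t ^ m).natTrailingDegree = 0 := by
    refine natTrailingDegree_eq_zero.2 (.inr ?_)
    rw [coeff_zero_eq_eval_zero, eval_pow, eval_sub, eval_X, eval_C, zero_sub]
    exact pow_ne_zero m (neg_ne_zero.2 (Nat.cast_add_one_ne_zero d))
  calc (multiplierPoly (rootFamily r)).natTrailingDegree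
      = (t ^ 1 * multiplierPoly (rootFamily r)).natTrailingDegree := by
        rw [natTrailingDegree_mul (ht 1) (multiplierPoly_rootFamily_ne_zero hr), htd, zero_add]
    _ = ∑ i, (p i).natTrailingDegree := by
        rw [hprod, natTrailingDegree_mul (ht d) (Finset.prod_ne_zero_iff.2 fun i _ => hp i), htd,
          zero_add, natTrailingDegree_prod _ fun i _ => hp i]
    _ = #{i | ∃ j ≠ i, r j = r i} := by
        simp only [p, natTrailingDegree_C_mul_X_sub_C (eval_formPoly_rootFamily_one_ne_zero hr _),
          eval_derivative_nodal_eq_zero_iff, Finset.card_filter]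

end PrescribedFixedPoints

section Specializations

variable {k : Type*} [Field k] {d : ℕ} {σ : Type*}

/-- The members of the family of pairs of forms with coefficients `c` that are obtained by
specializing each indeterminate `i` to an element of `s i`. -/
def specializations (s : σ → Set k) (c : Fin 2 → Fin (d + 1) → MvPolynomial σ k) :
    Set (EndLift k d) :=
  {f | ∃ r ∈ Set.univ.pi s, f.1 = fun i j => MvPolynomial.eval r (c i j)}

theorem exists_eq_zero_iff_eval_eq_zero {h : EndLift k d → k} (hh : h ∈ endCoordRing k d)
    (c : Fin 2 → Fin (d + 1) → MvPolynomial σ k) :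
    ∃ Q : MvPolynomial σ k, ∀ (f : EndLift k d) (r : σ → k),
      (f.1 = fun i j => MvPolynomial.eval r (c i j)) → (h f = 0 ↔ MvPolynomial.eval r Q = 0) := by
  obtain ⟨n, P, -, hP⟩ := hh
  refine ⟨MvPolynomial.bind₁ (fun ij => c ij.1 ij.2) P, fun f r hf => ?_⟩
  have hQ : MvPolynomial.eval r (MvPolynomial.bind₁ (fun ij => c ij.1 ij.2) P) =
      MvPolynomial.eval (fun ij => f.1 ij.1 ij.2) P := by
    simp only [hf]
    exact MvPolynomial.aeval_bind₁ r _ P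
  rw [hP, hQ, div_eq_zero_iff, or_iff_left (pow_ne_zero n f.2)]

theorem forall_mem_specializations_iff {s : σ → Set k} (hs : ∀ i, (s i).Infinite)
    {c : Fin 2 → Fin (d + 1) → MvPolynomial σ k} (hc : formRes c ≠ 0) {h : EndLift k d → k}
    {Q : MvPolynomial σ k} (hQ : ∀ (f : EndLift k d) (r : σ → k),
      (f.1 = fun i j => MvPolynomial.eval r (c i j)) → (h f = 0 ↔ MvPolynomial.eval r Q = 0)) :
    (∀ f ∈ specializations s c, h f = 0) ↔ Q = 0 := by
  refine ⟨fun h0 => ?_, fun hQ0 f ⟨r, _, hf⟩ => (hQ f r hf).2 (by rw [hQ0, map_zero])⟩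
  refine (mul_eq_zero.1 (MvPolynomial.funext_set s hs fun r hr => ?_)).resolve_left hc
  rw [map_mul, map_zero, mul_eq_zero, or_iff_not_imp_left, ← formRes_map]
  exact fun hres => (hQ ⟨_, hres⟩ r rfl).1 (h0 _ ⟨r, hr, rfl⟩)

theorem mem_vanishingIdeal_moduliPoint_image {A : Set (EndLift k d)} {h : moduliCoordRing k d} :
    h ∈ PrimeSpectrum.vanishingIdeal (moduliPoint '' A) ↔ ∀ f ∈ A, h.1 f = 0 := by
  simp only [PrimeSpectrum.mem_vanishingIdeal, Set.forall_mem_image]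
  rfl

theorem moduliPoint_mem_closure_image_iff {A : Set (EndLift k d)} {f : EndLift k d} :
    moduliPoint f ∈ closure (moduliPoint '' A) ↔
      ∀ h ∈ moduliCoordRing k d, (∀ g ∈ A, h g = 0) → h f = 0 := by
  rw [← PrimeSpectrum.zeroLocus_vanishingIdeal_eq_closure, PrimeSpectrum.mem_zeroLocus]
  exact ⟨fun hf h hh h0 => hf (mem_vanishingIdeal_moduliPoint_image (h := ⟨h, hh⟩).2 h0),
    fun hf h h0 => hf h.1 h.2 (mem_vanishingIdeal_moduliPoint_image.1 h0)⟩

theorem isIrreducible_image_specializations {s : σ → Set k} (hs : ∀ i, (s i).Infinite)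
    {c : Fin 2 → Fin (d + 1) → MvPolynomial σ k} (hc : formRes c ≠ 0) :
    IsIrreducible (moduliPoint '' specializations s c) := by
  refine PrimeSpectrum.isIrreducible_iff_vanishingIdeal_isPrime.2
    (Ideal.isPrime_iff.2 ⟨fun htop => ?_, fun {a b} hab => ?_⟩)
  · have h1 := mem_vanishingIdeal_moduliPoint_image.1 ((Ideal.eq_top_iff_one _).1 htop)
    refine one_ne_zero ((forall_mem_specializations_iff hs hc (Q := 1) fun f r _ => ?_).1 h1)
    rw [map_one]
    exact Iff.rfl
  · obtain ⟨P, hP⟩ := exists_eq_zero_iff_eval_eq_zero a.2.1 c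
    obtain ⟨Q, hQ⟩ := exists_eq_zero_iff_eval_eq_zero b.2.1 c
    have hPQ := forall_mem_specializations_iff hs hc (h := (a * b).1) (Q := P * Q) fun f r hf => by
      rw [map_mul, mul_eq_zero, ← hP f r hf, ← hQ f r hf]
      exact mul_eq_zero
    simp only [mem_vanishingIdeal_moduliPoint_image, forall_mem_specializations_iff hs hc hP,
      forall_mem_specializations_iff hs hc hQ, hPQ, mul_eq_zero] at hab ⊢
    exact hab

theorem moduliPoint_mem_closure_image_specializations {s : σ → Set k} (hs : ∀ i, (s i).Infinite)
    {c : Fin 2 → Fin (d + 1) → MvPolynomial σ k} {f : EndLift k d} {r : σ → k}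
    (hf : f.1 = fun i j => MvPolynomial.eval r (c i j)) :
    moduliPoint f ∈ closure (moduliPoint '' specializations s c) := by
  have hc : formRes c ≠ 0 := fun hc => f.2 (by simp only [hf, formRes_map, hc, map_zero])
  refine moduliPoint_mem_closure_image_iff.2 fun h hh h0 => ?_
  obtain ⟨Q, hQ⟩ := exists_eq_zero_iff_eval_eq_zero hh.1 c
  rw [hQ f r hf, (forall_mem_specializations_iff hs hc hQ).1 h0, map_zero]

end Specializations

section Strata

variable {k : Type*} [Field k] {d m : ℕ}

/-- The maps in `rootFamily` whose first `m` fixed points are `1`, a closed condition on the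
generic family. All fixed points are required to be nonzero. -/
def rootStratum (k : Type*) [Field k] (d m : ℕ) : Set (EndLift k d) :=
  {f | ∃ r : Fin (d + 1) → k,
    (∀ i, r i ≠ 0) ∧ (∀ i : Fin (d + 1), (i : ℕ) < m → r i = 1) ∧ f.1 = rootFamily r}

theorem rootStratum_antitone : Antitone (rootStratum k d) := fun _ _ hm _ ⟨r, hr, h1, hf⟩ =>
  ⟨r, hr, fun i hi => h1 i (hi.trans_le hm), hf⟩

theorem rootStratum_eq_specializations :
    rootStratum k d m = specializations (fun _ => {0}ᶜ)
      (rootFamily fun i : Fin (d + 1) => if (i : ℕ) < m then 1 else MvPolynomial.X i) := by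
  ext f
  simp only [rootStratum, specializations, rootFamily_map, Set.mem_ofPred_eq,
    apply_ite (MvPolynomial.eval _), map_one, MvPolynomial.eval_X]
  constructor
  · rintro ⟨r, hr, h1, hf⟩
    refine ⟨r, fun i _ => hr i, hf.trans (congrArg rootFamily (funext fun i => ?_))⟩
    split_ifs with hi
    exacts [h1 i hi, rfl]
  · rintro ⟨r, hr, hf⟩
    refine ⟨_, fun i => ?_, fun i hi => if_pos hi, hf⟩
    split_ifs
    exacts [one_ne_zero, hr i trivial]

theorem isIrreducible_image_rootStratum [Infinite k] :
    IsIrreducible (moduliPoint '' rootStratum k d m) := by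
  rw [rootStratum_eq_specializations]
  refine isIrreducible_image_specializations
    (fun _ => (Set.finite_singleton (0 : k)).infinite_compl)
    (formRes_rootFamily_ne_zero fun i => ?_)
  split_ifs
  exacts [one_ne_zero, MvPolynomial.X_ne_zero i]

theorem multiplierCoeff_eq_zero_of_mem_rootStratum [CharZero k] {j : ℕ} {f : EndLift k d}
    (hm : 2 ≤ m) (hmd : m ≤ d + 1) (hjm : j < m) (hf : f ∈ rootStratum k d m) :
    multiplierCoeff k d j f = 0 := by
  classical
  obtain ⟨r, hr, h1, hf⟩ := hf
  have hmultiple : Finset.univ.filter (fun i : Fin (d + 1) => (i : ℕ) < m) ⊆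
      Finset.univ.filter fun i => ∃ j ≠ i, r j = r i := by
    intro i hi
    simp only [Finset.mem_filter, Finset.mem_univ, true_and] at hi ⊢
    by_cases h0 : (i : ℕ) = 0
    · exact ⟨⟨1, by omega⟩, by simp [Fin.ext_iff, h0], by rw [h1 i hi, h1 _ (by simpa)]⟩
    · exact ⟨0, fun h => h0 (congrArg Fin.val h.symm),
        by rw [h1 i hi, h1 0 (by exact hm.trans_lt' two_pos)]⟩
  have hcard := Finset.card_le_card hmultiple
  rw [Fin.card_filter_val_lt, min_eq_right hmd,
    ← natTrailingDegree_multiplierPoly_rootFamily hr] at hcard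
  rw [multiplierCoeff, hf, coeff_eq_zero_of_lt_natTrailingDegree (hjm.trans_le hcard), zero_div]

theorem exists_mem_rootStratum_multiplierCoeff_ne_zero [CharZero k] (d m : ℕ) :
    ∃ f ∈ rootStratum k d m, ∃ j ≤ m, multiplierCoeff k d j f ≠ 0 := by
  classical
  let r : Fin (d + 1) → k := fun i => ((if (i : ℕ) < m then 1 else i + 2 : ℕ) : k)
  have hr (i : Fin (d + 1)) : r i ≠ 0 := Nat.cast_ne_zero.2 (by split_ifs <;> omega)
  have hres := formRes_rootFamily_ne_zero hr
  have hmultiple : Finset.univ.filter (fun i => ∃ j ≠ i, r j = r i) ⊆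
      Finset.univ.filter fun i : Fin (d + 1) => (i : ℕ) < m := by
    intro i hi
    simp only [Finset.mem_filter, Finset.mem_univ, true_and] at hi ⊢
    obtain ⟨j, hj, hji⟩ := hi
    by_contra him
    have hij := Nat.cast_injective hji
    rw [if_neg him] at hij
    split_ifs at hij <;> omega
  have hcard := Finset.card_le_card hmultiple
  rw [Fin.card_filter_val_lt, ← natTrailingDegree_multiplierPoly_rootFamily hr] at hcard
  refine ⟨⟨rootFamily r, hres⟩, ⟨r, hr, fun i hi => by simp [r, hi], rfl⟩, _,
    hcard.trans (min_le_right _ _), div_ne_zero ?_ hres⟩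
  exact coeff_natTrailingDegree_ne_zero.2 (multiplierPoly_rootFamily_ne_zero hr)

theorem closure_image_rootStratum_ssubset [CharZero k] (hm : 1 ≤ m) (hmd : m ≤ d) :
    closure (moduliPoint '' rootStratum k d (m + 1)) ⊂
      closure (moduliPoint '' rootStratum k d m) := by
  refine ssubset_of_subset_not_subset
    (closure_mono (Set.image_mono (rootStratum_antitone m.le_succ))) fun hle => ?_
  obtain ⟨f, hf, j, hj, hne⟩ := exists_mem_rootStratum_multiplierCoeff_ne_zero (k := k) d m
  refine hne (moduliPoint_mem_closure_image_iff.1 (hle (subset_closure ⟨f, hf, rfl⟩)) _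
    (multiplierCoeff_mem d j) fun g hg => ?_)
  exact multiplierCoeff_eq_zero_of_mem_rootStratum (by omega) (by omega) (by omega) hg

end Strata

section GoodReduction

variable {d : ℕ}

theorem hasGoodReductionOutside_of_eq_recipFamily {K : Type*} [Field K] [NumberField K]
    (S : Set (HeightOneSpectrum (𝓞 K))) {f : EndLift K d} (b : Fin d → 𝓞 K)
    (hf : f.1 = recipFamily 1 fun j => algebraMap (𝓞 K) K (b j)) :
    HasGoodReductionOutside S f := by
  refine ⟨f, endConj_refl f, fun v _ => ⟨1, ?_, ?_⟩⟩ <;> simp only [Units.val_one, one_mul, hf]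
  · rw [← map_one (algebraMap (𝓞 K) K), ← recipFamily_map]
    exact fun i j => v.valuation_le_one _
  · rw [formRes_recipFamily, one_pow, mul_one, map_pow, Valuation.map_neg, map_one, one_pow]

theorem moduliPoint_eq_of_endConj {k : Type*} [Field k] {f g : EndLift k d} (h : EndConj f g) :
    moduliPoint f = moduliPoint g :=
  PrimeSpectrum.ext <| Ideal.ext fun a => by
    change a.1 f = 0 ↔ a.1 g = 0
    rw [a.2.2 f g h]

theorem specializations_recipFamily_subset_goodReductionImage (K : Type*) [Field K]
    [NumberField K] (S : Set (HeightOneSpectrum (𝓞 K))) :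
    moduliPoint '' specializations (fun _ => Set.range ((↑) : ℤ → AlgebraicClosure K))
      (recipFamily 1 (MvPolynomial.X : Fin d → _)) ⊆ goodReductionImage K S d := by
  rintro _ ⟨f, ⟨r, hr, hf⟩, rfl⟩
  choose b hb using fun i => hr i trivial
  let g : EndLift K d := ⟨recipFamily 1 fun j => (b j : K),
    formRes_recipFamily_ne_zero one_ne_zero _⟩
  refine ⟨g, hasGoodReductionOutside_of_eq_recipFamily S (fun j => (b j : 𝓞 K)) ?_,
    congrArg moduliPoint (Subtype.ext (hf.trans ?_))⟩
  · simp only [g, map_intCast]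
  · simp only [g, EndLift.baseChange, recipFamily_map, map_one, MvPolynomial.eval_X, map_intCast,
      hb]

theorem moduliPoint_mem_closure_goodReductionImage {K : Type*} [Field K] [NumberField K]
    (S : Set (HeightOneSpectrum (𝓞 K))) {f : EndLift (AlgebraicClosure K) d}
    {c : AlgebraicClosure K} (hc : c ≠ 0) {b : Fin d → AlgebraicClosure K}
    (hf : f.1 = recipFamily c b) : moduliPoint f ∈ closure (goodReductionImage K S d) := by
  obtain ⟨a, rfl⟩ := IsAlgClosed.exists_pow_nat_eq c (Nat.succ_pos d)
  let g : EndLift (AlgebraicClosure K) d := ⟨recipFamily 1 fun j => a ^ (j : ℕ) * b j / a ^ d,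
    formRes_recipFamily_ne_zero one_ne_zero _⟩
  rw [moduliPoint_eq_of_endConj (endConj_recipFamily (g := g) (ne_zero_pow d.succ_ne_zero hc) hf
    rfl)]
  refine closure_mono (specializations_recipFamily_subset_goodReductionImage K S)
    (moduliPoint_mem_closure_image_specializations
      (fun _ => Set.infinite_range_of_injective Int.cast_injective)
      (r := fun j => a ^ (j : ℕ) * b j / a ^ d) ?_)
  simp only [g, recipFamily_map, map_one, MvPolynomial.eval_X]

theorem closure_image_rootStratum_subset {K : Type*} [Field K] [NumberField K]
    (S : Set (HeightOneSpectrum (𝓞 K))) (m : ℕ) :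
    closure (moduliPoint '' rootStratum (AlgebraicClosure K) d m) ⊆
      closure (goodReductionImage K S d) := by
  refine closure_minimal ?_ isClosed_closure
  rintro _ ⟨f, ⟨r, hr, -, hf⟩, rfl⟩
  refine moduliPoint_mem_closure_goodReductionImage S (neg_ne_zero.2 ?_) hf
  rw [coeff_nodal_zero]
  exact Finset.prod_ne_zero_iff.2 fun i _ => neg_ne_zero.2 (hr i)

end GoodReduction

section Dimension

open TopologicalSpace

variable {X : Type*} [TopologicalSpace X] {Z : Set X}

theorem isIrreducible_preimage_val {T : Set X} (hT : IsIrreducible T) (hTZ : T ⊆ Z) :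
    IsIrreducible ((↑) ⁻¹' T : Set Z) := by
  obtain ⟨x, hx⟩ := hT.nonempty
  refine ⟨⟨⟨x, hTZ hx⟩, hx⟩, ?_⟩
  rintro _ _ ⟨u, hu, rfl⟩ ⟨v, hv, rfl⟩ ⟨y, hyT, hyu⟩ ⟨z, hzT, hzv⟩
  obtain ⟨w, hwT, hw⟩ := hT.2 u v hu hv ⟨y, hyT, hyu⟩ ⟨z, hzT, hzv⟩
  exact ⟨⟨w, hTZ hwT⟩, hwT, hw⟩

theorem length_le_topologicalKrullDim {n : ℕ} {T : Fin (n + 1) → IrreducibleCloseds X}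
    (hT : StrictAnti T) (hTZ : ∀ i, (T i : Set X) ⊆ Z) :
    (n : WithBot ℕ∞) ≤ topologicalKrullDim Z := by
  let T' (i : Fin (n + 1)) : IrreducibleCloseds Z :=
    ⟨(↑) ⁻¹' (T i : Set X), isIrreducible_preimage_val (T i).isIrreducible (hTZ i),
      (T i).isClosed.preimage continuous_subtype_val⟩
  have hT' : StrictAnti T' := fun i j hij =>
    ⟨fun x hx => (hT hij).le hx, fun hle => (hT hij).not_ge fun x hx =>
      hle (show (⟨x, hTZ i hx⟩ : Z) ∈ T' i from hx)⟩
  exact Order.LTSeries.length_le_krullDim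
    (LTSeries.mk n (T' ∘ Fin.rev) (hT'.comp Fin.rev_strictAnti))

end Dimension

theorem proposition12_general (K : Type*) [Field K] [NumberField K]
    (S : Set (HeightOneSpectrum (𝓞 K))) (d : ℕ) :
    (d : WithBot ℕ∞) ≤ topologicalKrullDim (closure (goodReductionImage K S d)) := by
  let T (i : Fin (d + 1)) :
      TopologicalSpace.IrreducibleCloseds (ModuliSpace (AlgebraicClosure K) d) :=
    ⟨closure (moduliPoint '' rootStratum (AlgebraicClosure K) d (i + 1)),
      isIrreducible_image_rootStratum.closure, isClosed_closure⟩
  have hT : StrictAnti T := Fin.strictAnti_iff_succ_lt.2 fun i =>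
    closure_image_rootStratum_ssubset (Nat.le_add_left 1 i) i.2
  exact length_le_topologicalKrullDim hT fun i => closure_image_rootStratum_subset S (i + 1)

theorem proposition12 (d : ℕ) (hd : 2 ≤ d) : (d : WithBot ℕ∞) ≤ shafDimEmpty d :=
  le_iSup_of_le ℚ <| le_iSup_of_le inferInstance <| le_iSup_of_le inferInstance <|
    le_iSup_of_le ∅ <| proposition12_general ℚ _ d
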